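/- Let $X$ be a Banach space over $\mathbb K\in\{\mathbb R,\mathbb C\}$ with dual $X^*$. For a bounded set $L\subset X^*$ and $\varepsilon>0$ let $$s_\varepsilon(L)=\{x^*\in X^*:\ \operatorname{diam}_{\|\cdot\|}(V\cap L)>\varepsilon \text{ for every } w^*\text{-neighborhood } V \text{ of } x^*\},$$ and put $s^0_\varepsilon(L)=L$, $s^{\xi+1}_\varepsilon(L)=s_\varepsilon(s^\xi_\varepsilon(L))$, and $s^\xi_\varepsilon(L)=\bigcap_{\zeta<\xi}s^\zeta_\varepsilon(L)$ for limit ordinals $\xi$. Let $Sz_\varepsilon(L)=\min\{\xi<\omega_1: s^\xi_\varepsilon(L)=\varnothing\}$ if such $\xi$ exists, $Sz_\varepsilon(L)=\omega_1$ otherwise, and $Sz(L)=\sup_{\varepsilon>0}Sz_\varepsilon(L)$. The Szlenk index of a bounded linear operator $T:X\to Y$ is $Sz(T)=Sz(T^*B_{Y^*})$, where $B_{Y^*}$ is the closed unit ball of $Y^*$. Let $\mathcal L(X,Y)$ be the space of bounded linear operators from $X$ to $Y$ with the operator norm, and for $\xi<\omega_1$ let $$\mathcal{SZ}_\xi(X,Y)=\{T\in\mathcal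 L(X,Y): Sz(T)\leqslant\omega^\xi\}.$$ **Theorem.** Let $\xi<\omega_1$ and let $W,X,Y,Z$ be separable Banach spaces over $\mathbb K$. If $S\in\mathcal{SZ}_\xi(X,Y)$, $T\in\mathcal L(W,X)$ and $R\in\mathcal L(Y,Z)$, then $RST\in\mathcal{SZ}_\xi(W,Z)$. Moreover, $\mathcal{SZ}_\xi(X,Y)$ is a norm-closed linear subspace of $\mathcal L(X,Y)$. -/

import Mathlib

open scoped Ordinal

noncomputable section

/-- The `ε`-Szlenk derivation of a set `L` in the dual of `X`: all functionals `x'` such that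
every weak-star neighbourhood `V` of `x'` meets `L` in a set of norm diameter `> ε`. -/
def szlenkDeriv {𝕜 : Type*} [RCLike 𝕜] {X : Type*} [NormedAddCommGroup X] [NormedSpace 𝕜 X]
    (ε : ℝ) (L : Set (StrongDual 𝕜 X)) : Set (StrongDual 𝕜 X) :=
  {x' | ∀ V ∈ nhds (StrongDual.toWeakDual x' : WeakDual 𝕜 X),
    ENNReal.ofReal ε < Metric.ediam ((StrongDual.toWeakDual ⁻¹' V) ∩ L)}

/-- The transfinite iterates `s_ε^ξ(L)` of the Szlenk derivation (intersections at limits). -/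
def szlenkIter {𝕜 : Type*} [RCLike 𝕜] {X : Type*} [NormedAddCommGroup X] [NormedSpace 𝕜 X]
    (ε : ℝ) (L : Set (StrongDual 𝕜 X)) (ξ : Ordinal.{0}) : Set (StrongDual 𝕜 X) :=
  Ordinal.limitRecOn (motive := fun _ => Set (StrongDual 𝕜 X)) ξ L
    (fun _ A => szlenkDeriv ε A) (fun ξ _ A => ⋂ (ζ : Ordinal.{0}) (h : ζ < ξ), A ζ h)

open Classical in
/-- `Sz_ε(L)`: the least countable `ξ` with `s_ε^ξ(L) = ∅`, and `ω₁` if there is none. -/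
def szlenkIndexAt {𝕜 : Type*} [RCLike 𝕜] {X : Type*} [NormedAddCommGroup X] [NormedSpace 𝕜 X]
    (ε : ℝ) (L : Set (StrongDual 𝕜 X)) : Ordinal.{0} :=
  if {ξ : Ordinal.{0} | ξ < ω₁ ∧ szlenkIter ε L ξ = ∅}.Nonempty then
    sInf {ξ : Ordinal.{0} | ξ < ω₁ ∧ szlenkIter ε L ξ = ∅}
  else ω₁

/-- `Sz(L) = sup_{ε > 0} Sz_ε(L)`. -/
def szlenkIndex {𝕜 : Type*} [RCLike 𝕜] {X : Type*} [NormedAddCommGroup X] [NormedSpace 𝕜 X]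
    (L : Set (StrongDual 𝕜 X)) : Ordinal.{0} :=
  ⨆ ε : {ε : ℝ // 0 < ε}, szlenkIndexAt ε.1 L

/-- The Szlenk index of an operator `T : X → Y`, that is `Sz(T* B_{Y*})`, where `T*` is the
adjoint `y' ↦ y' ∘ T` and `B_{Y*}` is the closed unit ball of the dual of `Y`. -/
def operatorSzlenkIndex {𝕜 : Type*} [RCLike 𝕜] {X Y : Type*}
    [NormedAddCommGroup X] [NormedSpace 𝕜 X] [NormedAddCommGroup Y] [NormedSpace 𝕜 Y]
    (T : X →L[𝕜] Y) : Ordinal.{0} :=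
  szlenkIndex ((fun y' : StrongDual 𝕜 Y => y'.comp T) '' Metric.closedBall 0 1)

/-- The class `SZ_ξ(X, Y)` of bounded operators `X → Y` with Szlenk index at most `ω ^ ξ`. -/
def SZ (𝕜 : Type*) [RCLike 𝕜] (ξ : Ordinal.{0}) (X Y : Type*)
    [NormedAddCommGroup X] [NormedSpace 𝕜 X] [NormedAddCommGroup Y] [NormedSpace 𝕜 Y] :
    Set (X →L[𝕜] Y) :=
  {T | operatorSzlenkIndex T ≤ ω ^ ξ}

end

/-! An operator `T` puts the pseudometric `‖T* y - T* z‖` on the weak-star compact dual ball of `Y`.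
Up to a factor 2 in `ε`, the Szlenk derivations of its image under `T*` match separation derivations
of the ball itself (`mem_SZ_iff`). All operators `X → Y` thus act on one set, and composition and
norm limits become comparisons of pseudometrics.

Sums are the hard case. The derivation for `S + T` lies in the union of those for `S` and `T`. If a
point has ranks `r₁`, `r₂` under these two, it survives at most `natSum r₁ r₂` steps of the
derivation for the sum (`derivIter_eq_empty_of_subset_union`), and `ω ^ ξ` is closed under natural
sums. -/

/-! ### Natural sums below powers of `ω` -/

open Order in
/-- The natural (Hessenberg) sum of ordinals: the least function strictly increasing in both
arguments. -/
noncomputable def natSum (a b : Ordinal.{0}) : Ordinal.{0} :=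
  max (⨆ x : Set.Iio a, succ (natSum x.1 b)) (⨆ y : Set.Iio b, succ (natSum a y.1))
termination_by (a, b)
decreasing_by
  · exact Prod.Lex.left _ _ x.2
  · exact Prod.Lex.right _ y.2

theorem natSum_le_iff {a b c : Ordinal.{0}} :
    natSum a b ≤ c ↔ (∀ a' < a, natSum a' b < c) ∧ ∀ b' < b, natSum a b' < c := by
  rw [natSum, max_le_iff, Ordinal.iSup_le_iff, Ordinal.iSup_le_iff]
  simp

theorem natSum_lt_natSum_left {a a' : Ordinal.{0}} (h : a' < a) (b : Ordinal.{0}) :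
    natSum a' b < natSum a b :=
  (natSum_le_iff.1 le_rfl).1 a' h

theorem natSum_lt_natSum_right (a : Ordinal.{0}) {b b' : Ordinal.{0}} (h : b' < b) :
    natSum a b' < natSum a b :=
  (natSum_le_iff.1 le_rfl).2 b' h

theorem natSum_le_natSum {a a' b b' : Ordinal.{0}} (ha : a' ≤ a) (hb : b' ≤ b) :
    natSum a' b' ≤ natSum a b :=
  (StrictMono.monotone (f := fun x => natSum x b')
    (fun _ _ h => natSum_lt_natSum_left h b') ha).trans
    (StrictMono.monotone (f := natSum a) (fun _ _ h => natSum_lt_natSum_right a h) hb)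

theorem natSum_zero_zero : natSum 0 0 = 0 :=
  le_antisymm (natSum_le_iff.2 (by simp)) bot_le

theorem exists_nat_mul_add_of_lt {κ a : Ordinal.{0}} {n : ℕ} (h : a < κ * n) :
    ∃ i : ℕ, i < n ∧ ∃ r < κ, a = κ * i + r := by
  have hκ : κ ≠ 0 := by
    rintro rfl
    simp at h
  have h' : a / κ < n := (Ordinal.lt_mul_iff_div_lt hκ).1 h
  obtain ⟨i, hi⟩ := Ordinal.lt_omega0.1 (h'.trans (Ordinal.natCast_lt_omega0 n))
  refine ⟨i, ?_, a % κ, Ordinal.mod_lt _ hκ, ?_⟩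
  · rw [hi] at h'
    exact_mod_cast h'
  · rw [← hi, Ordinal.div_add_mod]

theorem lt_mul_succ_of_lt {κ r : Ordinal.{0}} (hr : r < κ) {i k : ℕ} (h : i < k) :
    κ * i + r < κ * k :=
  calc κ * i + r < κ * i + κ := by gcongr
    _ = κ * ((i + 1 : ℕ) : Ordinal) := by push_cast; rw [mul_add_one]
    _ ≤ κ * k := by
      gcongr
      exact_mod_cast h

/-- Decreasing an argument lowers either its coefficient, and then `hκ` keeps the sum of remainders
below one block `κ`, or only its remainder. -/
theorem natSum_mul_add_le {κ : Ordinal.{0}} (hκ : ∀ a < κ, ∀ b < κ, natSum a b < κ) :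
    ∀ a b : Ordinal.{0}, ∀ i j : ℕ, ∀ r < κ, ∀ s < κ, a = κ * i + r → b = κ * j + s →
      natSum a b ≤ κ * (i + j : ℕ) + natSum r s := by
  intro a
  induction a using WellFoundedLT.induction with | _ a iha
  intro b
  induction b using WellFoundedLT.induction with | _ b ihb
  intro i j r hr s hs hai hbj
  refine natSum_le_iff.2 ⟨fun a' ha' => ?_, fun b' hb' => ?_⟩
  · obtain ⟨i', hi', r', hr', rfl⟩ := exists_nat_mul_add_of_lt (n := i + 1)
      (ha'.trans (hai ▸ lt_mul_succ_of_lt hr (Nat.lt_succ_self i)))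
    refine (iha _ ha' b i' j r' hr' s hs rfl hbj).trans_lt ?_
    rcases (Nat.lt_succ_iff.1 hi').lt_or_eq with hlt | rfl
    · exact (lt_mul_succ_of_lt (hκ r' hr' s hs) (by omega)).trans_le le_self_add
    · rw [hai, add_lt_add_iff_left] at ha'
      gcongr
      exact natSum_lt_natSum_left ha' s
  · obtain ⟨j', hj', s', hs', rfl⟩ := exists_nat_mul_add_of_lt (n := j + 1)
      (hb'.trans (hbj ▸ lt_mul_succ_of_lt hs (Nat.lt_succ_self j)))
    refine (ihb _ hb' i j' r hr s' hs' hai rfl).trans_lt ?_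
    rcases (Nat.lt_succ_iff.1 hj').lt_or_eq with hlt | rfl
    · exact (lt_mul_succ_of_lt (hκ r hr s' hs') (by omega)).trans_le le_self_add
    · rw [hbj, add_lt_add_iff_left] at hb'
      gcongr
      exact natSum_lt_natSum_right r hb'

theorem natSum_lt_omega0_opow (ξ : Ordinal.{0}) :
    ∀ a < ω ^ ξ, ∀ b < ω ^ ξ, natSum a b < ω ^ ξ := by
  induction ξ using WellFoundedLT.induction with | _ ξ ih
  intro a ha b hb
  rcases eq_or_ne ξ 0 with rfl | hξ
  · rw [Ordinal.opow_zero, Order.lt_one_iff] at ha hb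
    simp [ha, hb, natSum_zero_zero]
  · obtain ⟨c, hc, n, hn⟩ := (Ordinal.lt_omega0_opow hξ).1 ha
    obtain ⟨d, hd, m, hm⟩ := (Ordinal.lt_omega0_opow hξ).1 hb
    have key : ∀ e ≤ max c d, ∀ k : ℕ, ω ^ e * (k : Ordinal.{0}) ≤ ω ^ max c d * k := by
      intro e he k
      gcongr
      exact Ordinal.omega0_pos
    have hm' := hm.trans_le (key d (le_max_right _ _) m)
    have hn' := hn.trans_le (key c (le_max_left _ _) n)
    have hmax : max c d < ξ := max_lt hc hd
    obtain ⟨i, -, r, hr, hai⟩ := exists_nat_mul_add_of_lt hn'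
    obtain ⟨j, -, s, hs, hbj⟩ := exists_nat_mul_add_of_lt hm'
    refine (natSum_mul_add_le (ih _ hmax) a b i j r hr s hs hai hbj).trans_lt ?_
    refine (lt_mul_succ_of_lt (ih _ hmax r hr s hs) (Nat.lt_succ_self (i + j))).trans ?_
    exact (Ordinal.lt_omega0_opow hξ).2 ⟨_, hmax, i + j + 2, by
      have : (0 : Ordinal.{0}) < ω ^ max c d := Ordinal.opow_pos _ Ordinal.omega0_pos
      gcongr
      simp⟩

/-! ### Iterated derivations and ranks -/

/-- Transfinite iterates of a derivation `D` started at `L`, with intersections at limits. -/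
noncomputable def derivIter {E : Type*} (D : Set E → Set E) (L : Set E) (ξ : Ordinal.{0}) :
    Set E :=
  Ordinal.limitRecOn (motive := fun _ => Set E) ξ L
    (fun _ A => D A) (fun ξ _ A => ⋂ (ζ : Ordinal.{0}) (h : ζ < ξ), A ζ h)

section derivIter

variable {E F : Type*} {D : Set E → Set E} {L : Set E}

@[simp]
theorem derivIter_zero : derivIter D L 0 = L := Ordinal.limitRecOn_zero ..

@[simp]
theorem derivIter_add_one (ξ : Ordinal.{0}) :
    derivIter D L (ξ + 1) = D (derivIter D L ξ) := Ordinal.limitRecOn_add_one ..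

theorem derivIter_limit {ξ : Ordinal.{0}} (hξ : Order.IsSuccLimit ξ) :
    derivIter D L ξ = ⋂ (ζ : Ordinal.{0}) (_ : ζ < ξ), derivIter D L ζ :=
  Ordinal.limitRecOn_limit _ _ _ _ hξ

theorem mapsTo_derivIter {D' : Set F → Set F} {L' : Set F} {f : E → F} (hL : Set.MapsTo f L L')
    (hD : ∀ ξ, Set.MapsTo f (derivIter D L ξ) (derivIter D' L' ξ) →
      Set.MapsTo f (D (derivIter D L ξ)) (D' (derivIter D' L' ξ))) (ξ : Ordinal.{0}) :
    Set.MapsTo f (derivIter D L ξ) (derivIter D' L' ξ) := by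
  induction ξ using Ordinal.limitRecOn with
  | zero => simpa using hL
  | add_one ξ ih => simpa using hD ξ ih
  | limit ξ hξ ih =>
    intro x hx
    rw [derivIter_limit hξ, Set.mem_iInter₂] at hx ⊢
    exact fun ζ h => ih ζ h (hx ζ h)

variable [TopologicalSpace E]

/-- A derivation of closed sets: it sends closed sets to smaller closed sets. -/
structure IsClosedDerivation (D : Set E → Set E) : Prop where
  isClosed : ∀ {A}, IsClosed A → IsClosed (D A)
  subset : ∀ {A}, IsClosed A → D A ⊆ A

namespace IsClosedDerivation

theorem isClosed_derivIter (hD : IsClosedDerivation D) (hL : IsClosed L) (ξ : Ordinal.{0}) :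
    IsClosed (derivIter D L ξ) := by
  induction ξ using Ordinal.limitRecOn with
  | zero => simpa using hL
  | add_one ξ ih => simpa using hD.isClosed ih
  | limit ξ hξ ih =>
    rw [derivIter_limit hξ]
    exact isClosed_iInter fun ζ => isClosed_iInter (ih ζ)

theorem derivIter_antitone (hD : IsClosedDerivation D) (hL : IsClosed L) :
    Antitone (derivIter D L) := by
  intro η ξ h
  induction ξ using Ordinal.limitRecOn with
  | zero => simp [nonpos_iff_eq_zero.1 h]
  | add_one ξ ih =>
    rcases h.lt_or_eq with h | rfl
    · rw [derivIter_add_one]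
      exact (hD.subset (hD.isClosed_derivIter hL ξ)).trans (ih (Order.lt_add_one_iff.1 h))
    · rfl
  | limit ξ hξ ih =>
    rcases h.lt_or_eq with h | rfl
    · rw [derivIter_limit hξ]
      exact Set.iInter₂_subset η h
    · rfl

/-- Since limit stages are intersections, a point can first disappear only at a successor stage; `r`
is its predecessor. -/
theorem exists_rank (hD : IsClosedDerivation D) (hL : IsClosed L) {x : E} (hx : x ∈ L)
    {κ : Ordinal.{0}} (hκ : x ∉ derivIter D L κ) :
    ∃ r < κ, ∀ ξ, x ∈ derivIter D L ξ ↔ ξ ≤ r := by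
  induction κ using Ordinal.limitRecOn with
  | zero => simp [hx] at hκ
  | add_one κ ih =>
    by_cases h : x ∈ derivIter D L κ
    · refine ⟨κ, lt_add_one κ, fun ξ => ⟨fun hξ => ?_, fun hξ => ?_⟩⟩
      · by_contra! hlt
        exact hκ (hD.derivIter_antitone hL (Order.add_one_le_of_lt hlt) hξ)
      · exact hD.derivIter_antitone hL hξ h
    · obtain ⟨r, hr, h⟩ := ih h
      exact ⟨r, hr.trans (lt_add_one κ), h⟩
  | limit κ hlim ih =>
    rw [derivIter_limit hlim] at hκ
    simp only [Set.mem_iInter, not_forall] at hκ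
    obtain ⟨ζ, hζ, h⟩ := hκ
    obtain ⟨r, hr, h⟩ := ih ζ hζ h
    exact ⟨r, hr.trans hζ, h⟩

end IsClosedDerivation

/-- Pairs of ordinals are well partially ordered, so the antichain of minimal pairs is finite and
every admissible pair dominates one of them. -/
theorem exists_finite_minimal_natSum (γ : Ordinal.{0}) :
    ∃ M : Set (Ordinal.{0} × Ordinal.{0}), M.Finite ∧ (∀ p ∈ M, γ ≤ natSum p.1 p.2) ∧
      ∀ a b, γ ≤ natSum a b → ∃ p ∈ M, p.1 ≤ a ∧ p.2 ≤ b := by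
  have hpwo : (Set.univ : Set (Ordinal.{0} × Ordinal.{0})).IsPWO := by
    rw [← Set.univ_prod_univ]
    exact (Set.IsPWO.of_linearOrder _).prod (Set.IsPWO.of_linearOrder _)
  set S : Set (Ordinal.{0} × Ordinal.{0}) := {p | γ ≤ natSum p.1 p.2}
  refine ⟨{p | Minimal (· ∈ S) p}, ?_, fun p hp => hp.1, fun a b hab => ?_⟩
  · exact IsAntichain.finite_of_partiallyWellOrderedOn (setOfPred_minimal_antichain _)
      (hpwo.mono (Set.subset_univ _))
  · obtain ⟨p, hp, hmin⟩ := (hpwo.mono (Set.subset_univ S)).exists_le_minimal (a := (a, b)) hab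
    exact ⟨p, hmin, hp.1, hp.2⟩

/-- If two derivations vanish after `ω ^ ξ` steps, so does any finitely subadditive derivation
contained in their union. -/
theorem derivIter_eq_empty_of_subset_union {D D₁ D₂ : Set E → Set E} (hL : IsClosed L)
    (h₁ : IsClosedDerivation D₁) (h₂ : IsClosedDerivation D₂)
    (hm : Monotone D) (hm₁ : Monotone D₁) (hm₂ : Monotone D₂)
    (hD : IsClosedDerivation D) (hD₁₂ : ∀ A, D A ⊆ D₁ A ∪ D₂ A)
    (hu : ∀ {M : Set (Ordinal.{0} × Ordinal.{0})} (A : Ordinal.{0} × Ordinal.{0} → Set E),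
      M.Finite → D (⋃ p ∈ M, A p) ⊆ ⋃ p ∈ M, D (A p))
    {ξ : Ordinal.{0}} (he₁ : derivIter D₁ L (ω ^ ξ) = ∅) (he₂ : derivIter D₂ L (ω ^ ξ) = ∅) :
    derivIter D L (ω ^ ξ) = ∅ := by
  choose! r₁ hr₁ hr₁' using fun x (hx : x ∈ L) =>
    h₁.exists_rank hL hx (κ := ω ^ ξ) (by simp [he₁])
  choose! r₂ hr₂ hr₂' using fun x (hx : x ∈ L) =>
    h₂.exists_rank hL hx (κ := ω ^ ξ) (by simp [he₂])
  have hsub : ∀ γ, derivIter D L γ ⊆ L := fun γ => by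
    simpa using hD.derivIter_antitone hL (zero_le (a := γ))
  have key : ∀ γ, ∀ x ∈ derivIter D L γ, γ ≤ natSum (r₁ x) (r₂ x) := by
    intro γ
    induction γ using Ordinal.limitRecOn with
    | zero => intros; exact zero_le
    | add_one γ ih =>
      intro x hx
      have hxL := hsub _ hx
      rw [derivIter_add_one] at hx
      -- Finitely many closed pieces, indexed by minimal pairs, cover stage `γ`, so finite
      -- subadditivity applies.
      obtain ⟨M, hM, hMγ, hMle⟩ := exists_finite_minimal_natSum γ
      have hcover : derivIter D L γ ⊆ ⋃ p ∈ M, derivIter D₁ L p.1 ∩ derivIter D₂ L p.2 := by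
        intro y hy
        obtain ⟨p, hp, hp₁, hp₂⟩ := hMle _ _ (ih y hy)
        exact Set.mem_iUnion₂.2 ⟨p, hp, (hr₁' y (hsub _ hy) _).2 hp₁, (hr₂' y (hsub _ hy) _).2 hp₂⟩
      obtain ⟨p, hp, hxp⟩ := Set.mem_iUnion₂.1 (hu _ hM (hm hcover hx))
      have hc₁ := h₁.isClosed_derivIter hL p.1
      have hc₂ := h₂.isClosed_derivIter hL p.2
      have hx' := hD.subset (hc₁.inter hc₂) hxp
      rw [← Order.succ_eq_add_one, Order.succ_le_iff]
      refine (hMγ p hp).trans_lt ?_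
      -- The ranks of `x` already dominate `p`; one more derivation raises one of them strictly.
      rcases hD₁₂ _ hxp with h | h
      · have hs := hm₁ Set.inter_subset_left h
        rw [← derivIter_add_one (D := D₁), hr₁' x hxL] at hs
        exact (natSum_lt_natSum_left (lt_add_one p.1) p.2).trans_le
          (natSum_le_natSum hs ((hr₂' x hxL _).1 hx'.2))
      · have hs := hm₂ Set.inter_subset_right h
        rw [← derivIter_add_one (D := D₂), hr₂' x hxL] at hs
        exact (natSum_lt_natSum_right p.1 (lt_add_one p.2)).trans_le
          (natSum_le_natSum ((hr₁' x hxL _).1 hx'.1) hs)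
    | limit γ hγ ih =>
      intro x hx
      rw [derivIter_limit hγ, Set.mem_iInter₂] at hx
      by_contra! hlt
      exact (lt_add_one _).not_ge
        (ih _ (hγ.add_one_lt hlt) x (hx _ (hγ.add_one_lt hlt)))
  refine Set.eq_empty_of_forall_notMem fun x hx => ?_
  have hxL := hsub _ hx
  exact (natSum_lt_omega0_opow ξ _ (hr₁ x hxL) _ (hr₂ x hxL)).not_ge (key _ x hx)

end derivIter

/-! ### Separation derivations of a pseudometric -/

section sepDeriv

variable {E : Type*} [TopologicalSpace E]

/-- The closure of the set of points that are limits of points of `A` at `d`-distance greater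
than `ε` from them. -/
def sepDeriv (d : E → E → ℝ) (ε : ℝ) (A : Set E) : Set E :=
  closure {x | x ∈ closure {y ∈ A | ε < d x y}}

theorem sepDeriv_mono (d : E → E → ℝ) (ε : ℝ) : Monotone (sepDeriv d ε) := fun _ _ h =>
  closure_mono fun _ hx => closure_mono (Set.inter_subset_inter_left _ h) hx

theorem isClosedDerivation_sepDeriv (d : E → E → ℝ) (ε : ℝ) :
    IsClosedDerivation (sepDeriv d ε) where
  isClosed _ := isClosed_closure
  subset hA := closure_minimal (fun _ hx => closure_minimal (fun _ hy => hy.1) hA hx) hA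

/-- Distances are measured from the fixed point `x`, so each witness lies in a single piece. With
diameters, the two far points could lie in different pieces. -/
theorem sepDeriv_biUnion_subset (d : E → E → ℝ) (ε : ℝ) {ι : Type*} {M : Set ι}
    (A : ι → Set E) (hM : M.Finite) :
    sepDeriv d ε (⋃ p ∈ M, A p) ⊆ ⋃ p ∈ M, sepDeriv d ε (A p) := by
  unfold sepDeriv
  rw [← hM.closure_biUnion]
  refine closure_mono fun x hx => ?_
  have : {y ∈ ⋃ p ∈ M, A p | ε < d x y} = ⋃ p ∈ M, {y ∈ A p | ε < d x y} := by
    ext y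
    simp only [Set.mem_iUnion, Set.mem_ofPred_eq, exists_prop]
    tauto
  rw [Set.mem_ofPred_eq, this, hM.closure_biUnion] at hx
  simpa using hx

theorem sepDeriv_add_subset {d d₁ d₂ : E → E → ℝ} (h : ∀ x y, d x y ≤ d₁ x y + d₂ x y)
    (ε : ℝ) (A : Set E) :
    sepDeriv d (2 * ε) A ⊆ sepDeriv d₁ ε A ∪ sepDeriv d₂ ε A := by
  unfold sepDeriv
  rw [← closure_union]
  refine closure_mono fun x hx => ?_
  have : {y ∈ A | 2 * ε < d x y} ⊆ {y ∈ A | ε < d₁ x y} ∪ {y ∈ A | ε < d₂ x y} := by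
    rintro y ⟨hy, hlt⟩
    by_contra hcon
    simp only [Set.mem_union, Set.mem_ofPred_eq, hy, true_and, not_or, not_lt] at hcon
    linarith [h x y]
  have hx' := closure_mono this hx
  rwa [closure_union] at hx'

theorem mapsTo_sepDeriv {F : Type*} [TopologicalSpace F] {d : E → E → ℝ} {d' : F → F → ℝ}
    {ε ε' : ℝ} {f : E → F} (hf : Continuous f) {A : Set E} {A' : Set F} (hAc : IsClosed A)
    (hd : ∀ x ∈ A, ∀ y ∈ A, ε < d x y → ε' < d' (f x) (f y)) (hA : Set.MapsTo f A A') :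
    Set.MapsTo f (sepDeriv d ε A) (sepDeriv d' ε' A') := by
  refine Set.MapsTo.closure (fun x hx => ?_) hf
  have hxA : x ∈ A := closure_minimal (fun _ hy => hy.1) hAc hx
  exact Set.MapsTo.closure (t := {y ∈ A' | ε' < d' (f x) y})
    (fun y hy => ⟨hA hy.1, hd x hxA y hy.1 hy.2⟩) hf hx

theorem derivIter_sepDeriv_eq_empty {F : Type*} [TopologicalSpace F] {d : E → E → ℝ}
    {d' : F → F → ℝ} {ε ε' : ℝ} {f : E → F} (hf : Continuous f) {L : Set E} {L' : Set F}
    (hLc : IsClosed L) (hd : ∀ x ∈ L, ∀ y ∈ L, ε < d x y → ε' < d' (f x) (f y))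
    (hL : Set.MapsTo f L L') {ξ : Ordinal.{0}} (h : derivIter (sepDeriv d' ε') L' ξ = ∅) :
    derivIter (sepDeriv d ε) L ξ = ∅ := by
  have hD := isClosedDerivation_sepDeriv d ε
  have hsub : ∀ η, derivIter (sepDeriv d ε) L η ⊆ L := fun η => by
    simpa using hD.derivIter_antitone hLc (zero_le (a := η))
  refine Set.eq_empty_of_forall_notMem fun x hx => ?_
  simpa [h] using mapsTo_derivIter (D' := sepDeriv d' ε') hL
    (fun η hA => mapsTo_sepDeriv hf (hD.isClosed_derivIter hLc η)
      (fun x hx y hy => hd x (hsub η hx) y (hsub η hy)) hA) ξ hx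

end sepDeriv

/-! ### From the Szlenk derivation to the dual ball of the codomain -/

section Szlenk

variable {𝕜 : Type*} [RCLike 𝕜] {X Y Z : Type*}
  [NormedAddCommGroup X] [NormedSpace 𝕜 X] [NormedAddCommGroup Y] [NormedSpace 𝕜 Y]
  [NormedAddCommGroup Z] [NormedSpace 𝕜 Z]

/-- The Szlenk derivation transported to subsets of the weak dual. -/
def weakSzlenkDeriv (ε : ℝ) (A : Set (WeakDual 𝕜 X)) : Set (WeakDual 𝕜 X) :=
  WeakDual.toStrongDual ⁻¹' szlenkDeriv ε (StrongDual.toWeakDual ⁻¹' A)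

theorem mem_weakSzlenkDeriv {ε : ℝ} {A : Set (WeakDual 𝕜 X)} {x : WeakDual 𝕜 X} :
    x ∈ weakSzlenkDeriv ε A ↔ ∀ V ∈ nhds x, ENNReal.ofReal ε <
      Metric.ediam (StrongDual.toWeakDual ⁻¹' (V ∩ A)) := Iff.rfl

theorem preimage_szlenkIter (ε : ℝ) (L : Set (StrongDual 𝕜 X)) (ξ : Ordinal.{0}) :
    WeakDual.toStrongDual ⁻¹' szlenkIter ε L ξ =
      derivIter (weakSzlenkDeriv ε) (WeakDual.toStrongDual ⁻¹' L) ξ := by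
  change WeakDual.toStrongDual ⁻¹' derivIter (szlenkDeriv ε) L ξ = _
  induction ξ using Ordinal.limitRecOn with
  | zero => simp
  | add_one ξ ih =>
    rw [derivIter_add_one, derivIter_add_one, ← ih]
    rfl
  | limit ξ hξ ih =>
    rw [derivIter_limit hξ, derivIter_limit hξ, Set.preimage_iInter₂]
    exact Set.iInter₂_congr ih

theorem isClosedDerivation_weakSzlenkDeriv (ε : ℝ) :
    IsClosedDerivation (weakSzlenkDeriv (𝕜 := 𝕜) (X := X) ε) where
  isClosed {A} _ := by
    refine isClosed_iff_nhds.2 fun x hx => mem_weakSzlenkDeriv.2 fun V hV => ?_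
    obtain ⟨U, hUV, hU, hxU⟩ := mem_nhds_iff.1 hV
    obtain ⟨y, hyU, hy⟩ := hx U (hU.mem_nhds hxU)
    refine (mem_weakSzlenkDeriv.1 hy U (hU.mem_nhds hyU)).trans_le (Metric.ediam_mono ?_)
    exact Set.preimage_mono (Set.inter_subset_inter_left A hUV)
  subset {A} hA x hx := by
    refine isClosed_iff_nhds.1 hA x fun V hV => ?_
    by_contra hcon
    have := mem_weakSzlenkDeriv.1 hx V hV
    simp [Set.not_nonempty_iff_eq_empty.1 hcon] at this

theorem szlenkIndexAt_le_iff {ε : ℝ} {L : Set (StrongDual 𝕜 X)}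
    (hL : IsClosed (WeakDual.toStrongDual ⁻¹' L : Set (WeakDual 𝕜 X)))
    {κ : Ordinal.{0}} (hκ : κ < ω₁) :
    szlenkIndexAt ε L ≤ κ ↔
      derivIter (weakSzlenkDeriv ε) (WeakDual.toStrongDual ⁻¹' L) κ = ∅ := by
  have hiff : ∀ η, szlenkIter ε L η = ∅ ↔
      derivIter (weakSzlenkDeriv ε) (WeakDual.toStrongDual ⁻¹' L) η = ∅ := fun η => by
    rw [← preimage_szlenkIter, Set.preimage_eq_empty_iff,
      (WeakDual.toStrongDual (𝕜 := 𝕜) (E := X)).surjective.range_eq, Set.disjoint_univ]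
  unfold szlenkIndexAt
  rw [← hiff]
  split_ifs with h
  · refine ⟨fun hle => ?_, fun he => csInf_le' ⟨hκ, he⟩⟩
    have hmem := csInf_mem h
    rw [hiff]
    exact Set.subset_eq_empty
      ((isClosedDerivation_weakSzlenkDeriv ε).derivIter_antitone hL hle) ((hiff _).1 hmem.2)
  -- The default value `ω₁` exceeds the countable `κ`.
  · exact ⟨fun hle => absurd hle hκ.not_ge, fun he => absurd ⟨κ, hκ, he⟩ h⟩

theorem szlenkIndexAt_le_omega_one (ε : ℝ) (L : Set (StrongDual 𝕜 X)) :
    szlenkIndexAt ε L ≤ ω₁ := by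
  unfold szlenkIndexAt
  split_ifs with h
  · exact (csInf_mem h).1.le
  · exact le_rfl

theorem szlenkIndex_le_iff {L : Set (StrongDual 𝕜 X)} {κ : Ordinal.{0}} :
    szlenkIndex L ≤ κ ↔ ∀ ε > 0, szlenkIndexAt ε L ≤ κ := by
  have hb : BddAbove (Set.range fun ε : {ε : ℝ // 0 < ε} => szlenkIndexAt ε.1 L) :=
    ⟨ω₁, by rintro _ ⟨ε, rfl⟩; exact szlenkIndexAt_le_omega_one _ _⟩
  have : Nonempty {ε : ℝ // 0 < ε} := ⟨⟨1, one_pos⟩⟩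
  unfold szlenkIndex
  rw [ciSup_le_iff hb]
  simp

/-- The adjoint of `T` as a map between weak duals. -/
noncomputable def weakAdjoint (T : X →L[𝕜] Y) (y : WeakDual 𝕜 Y) : WeakDual 𝕜 X :=
  StrongDual.toWeakDual ((WeakDual.toStrongDual y).comp T)

theorem continuous_weakAdjoint (T : X →L[𝕜] Y) : Continuous (weakAdjoint T) :=
  WeakDual.continuous_of_continuous_eval fun x => WeakDual.eval_continuous (T x)

/-- The pseudometric `(y, z) ↦ ‖T* y - T* z‖` on the dual of `Y`. -/
noncomputable def adjointDist (T : X →L[𝕜] Y) (y z : WeakDual 𝕜 Y) : ℝ :=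
  dist (WeakDual.toStrongDual (weakAdjoint T y)) (WeakDual.toStrongDual (weakAdjoint T z))

theorem adjointDist_eq (T : X →L[𝕜] Y) (y z : WeakDual 𝕜 Y) :
    adjointDist T y z = ‖(WeakDual.toStrongDual y - WeakDual.toStrongDual z).comp T‖ := by
  rw [ContinuousLinearMap.sub_comp, ← dist_eq_norm]
  rfl

variable (𝕜 Y) in
/-- The closed unit ball of the dual of `Y`, as a subset of the weak dual. -/
def weakUnitBall : Set (WeakDual 𝕜 Y) :=
  WeakDual.toStrongDual ⁻¹' Metric.closedBall (0 : StrongDual 𝕜 Y) 1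

theorem isCompact_weakUnitBall : IsCompact (weakUnitBall 𝕜 Y) :=
  WeakDual.isCompact_closedBall (𝕜 := 𝕜) (E := Y) 0 1

theorem isClosed_weakUnitBall : IsClosed (weakUnitBall 𝕜 Y) :=
  isCompact_weakUnitBall.isClosed

theorem mapsTo_sepDeriv_weakSzlenkDeriv (T : X →L[𝕜] Y) {ε : ℝ} (hε : 0 ≤ ε) {A' : Set (WeakDual 𝕜 Y)}
    {A : Set (WeakDual 𝕜 X)} (hA : IsClosed A) (h : Set.MapsTo (weakAdjoint T) A' A) :
    Set.MapsTo (weakAdjoint T) (sepDeriv (adjointDist T) ε A') (weakSzlenkDeriv ε A) := by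
  have hT := continuous_weakAdjoint T
  refine ((isClosedDerivation_weakSzlenkDeriv ε).isClosed hA).closure_eq ▸
    Set.MapsTo.closure (fun y hy => mem_weakSzlenkDeriv.2 fun V hV => ?_) hT
  have hyA : weakAdjoint T y ∈ A :=
    hA.closure_eq ▸ Set.MapsTo.closure (fun z hz => h hz.1) hT hy
  obtain ⟨z, hzV, hzA, hz⟩ := mem_closure_iff_nhds.1 hy _ (hT.continuousAt hV)
  have hpos : 0 < adjointDist T y z := hε.trans_lt hz
  calc ENNReal.ofReal ε < ENNReal.ofReal (adjointDist T y z) :=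
        ENNReal.ofReal_lt_ofReal_iff'.2 ⟨hz, hpos⟩
    _ = edist _ _ := (edist_dist _ _).symm
    _ ≤ _ := Metric.edist_le_ediam_of_mem
          (show _ ∈ StrongDual.toWeakDual ⁻¹' (V ∩ A) from ⟨mem_of_mem_nhds hV, hyA⟩)
          (show _ ∈ StrongDual.toWeakDual ⁻¹' (V ∩ A) from ⟨hzV, h hzA⟩)

/-- If a neighbourhood met `A` only within `ε` of `x`, the diameter would be at most `2 * ε`. So `x`
is a weak-star limit of points farther away, and compactness lifts this limit to `A'`. -/
theorem weakSzlenkDeriv_subset_image (T : X →L[𝕜] Y) {ε : ℝ}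
    {A' : Set (WeakDual 𝕜 Y)} {A : Set (WeakDual 𝕜 X)} (hA' : IsCompact A')
    (h : A ⊆ weakAdjoint T '' A') :
    weakSzlenkDeriv (2 * ε) A ⊆ weakAdjoint T '' sepDeriv (adjointDist T) ε A' := by
  intro x hx
  set C : Set (WeakDual 𝕜 Y) := {y ∈ A' | ε <
    dist (WeakDual.toStrongDual x) (WeakDual.toStrongDual (weakAdjoint T y))}
  have hC : IsCompact (closure C) := hA'.closure_of_subset fun _ hy => hy.1
  have hxC : x ∈ closure (weakAdjoint T '' C) := by
    refine mem_closure_iff_nhds.2 fun V hV => ?_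
    by_contra hcon
    refine (mem_weakSzlenkDeriv.1 hx V hV).not_ge (Metric.ediam_le fun u hu v hv => ?_)
    have key : ∀ w ∈ StrongDual.toWeakDual ⁻¹' (V ∩ A),
        dist (WeakDual.toStrongDual x) w ≤ ε := by
      intro w hw
      by_contra! hlt
      obtain ⟨y, hy, hyw⟩ := h hw.2
      refine hcon ⟨weakAdjoint T y, hyw ▸ hw.1, y, ⟨hy, ?_⟩, rfl⟩
      rw [hyw]
      exact hlt
    rw [edist_dist]
    refine ENNReal.ofReal_le_ofReal ?_
    linarith [dist_triangle_left u v (WeakDual.toStrongDual x), key u hu, key v hv]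
  obtain ⟨y, hy, rfl⟩ := closure_minimal (Set.image_mono subset_closure)
    (hC.image (continuous_weakAdjoint T)).isClosed hxC
  exact ⟨y, subset_closure hy, rfl⟩

theorem derivIter_weakSzlenkDeriv_subset_image (T : X →L[𝕜] Y) {ε : ℝ}
    {L : Set (WeakDual 𝕜 Y)} (hL : IsCompact L) (ξ : Ordinal.{0}) :
    derivIter (weakSzlenkDeriv (2 * ε)) (weakAdjoint T '' L) ξ ⊆
      weakAdjoint T '' derivIter (sepDeriv (adjointDist T) ε) L ξ := by
  have hD := isClosedDerivation_sepDeriv (adjointDist T) ε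
  have hcl := hD.isClosed_derivIter hL.isClosed
  have hanti := hD.derivIter_antitone hL.isClosed
  have hcpt : ∀ ξ, IsCompact (derivIter (sepDeriv (adjointDist T) ε) L ξ) := fun ξ =>
    hL.of_isClosed_subset (hcl ξ) (by simpa using hanti (zero_le (a := ξ)))
  induction ξ using Ordinal.limitRecOn with
  | zero => simp
  | add_one ξ ih =>
    rw [derivIter_add_one, derivIter_add_one]
    exact weakSzlenkDeriv_subset_image T (hcpt ξ) ih
  | limit ξ hξ ih =>
    intro x hx
    rw [derivIter_limit hξ, Set.mem_iInter₂] at hx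
    -- The lift of `x` may vary with the stage; nested compact fibres provide a common one.
    have hfib : IsClosed (weakAdjoint T ⁻¹' {x}) :=
      isClosed_singleton.preimage (continuous_weakAdjoint T)
    have : Nonempty (Set.Iio ξ) := ⟨⟨0, hξ.bot_lt⟩⟩
    have hne := IsCompact.nonempty_iInter_of_directed_nonempty_isCompact_isClosed
      (fun ζ : Set.Iio ξ =>
        derivIter (sepDeriv (adjointDist T) ε) L ζ ∩ weakAdjoint T ⁻¹' {x})
      (Antitone.directed_ge fun ζ η h => Set.inter_subset_inter_left _ (hanti h))
      (fun ζ => by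
        obtain ⟨y, hy, hyx⟩ := ih ζ ζ.2 (hx ζ ζ.2)
        exact ⟨y, hy, hyx⟩)
      (fun ζ => (hcpt ζ).inter_right hfib) (fun ζ => (hcl ζ).inter hfib)
    obtain ⟨y, hy⟩ := hne
    rw [Set.mem_iInter] at hy
    refine ⟨y, ?_, (hy ⟨0, hξ.bot_lt⟩).2⟩
    rw [derivIter_limit hξ, Set.mem_iInter₂]
    exact fun ζ hζ => (hy ⟨ζ, hζ⟩).1

theorem omega0_opow_lt_omega_one {ξ : Ordinal.{0}} (hξ : ξ < ω₁) : ω ^ ξ < ω₁ :=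
  Ordinal.isPrincipal_opow_omega 1 Ordinal.omega0_lt_omega_one hξ

/-- Membership in `SZ` in terms of separation derivations of the dual ball of the codomain. -/
theorem mem_SZ_iff {ξ : Ordinal.{0}} (hξ : ξ < ω₁) {T : X →L[𝕜] Y} :
    T ∈ SZ 𝕜 ξ X Y ↔
      ∀ ε > 0, derivIter (sepDeriv (adjointDist T) ε) (weakUnitBall 𝕜 Y) (ω ^ ξ) = ∅ := by
  have himg : (WeakDual.toStrongDual ⁻¹'
      ((fun y' : StrongDual 𝕜 Y => y'.comp T) '' Metric.closedBall 0 1) : Set (WeakDual 𝕜 X)) =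
      weakAdjoint T '' weakUnitBall 𝕜 Y := rfl
  have hcl : IsClosed (weakAdjoint T '' weakUnitBall 𝕜 Y) :=
    (isCompact_weakUnitBall.image (continuous_weakAdjoint T)).isClosed
  change szlenkIndex _ ≤ ω ^ ξ ↔ _
  rw [szlenkIndex_le_iff]
  simp_rw [szlenkIndexAt_le_iff (himg ▸ hcl) (omega0_opow_lt_omega_one hξ), himg]
  constructor <;> intro h ε hε
  · refine Set.eq_empty_of_forall_notMem fun y hy => ?_
    have := mapsTo_derivIter (Set.mapsTo_image (weakAdjoint T) (weakUnitBall 𝕜 Y))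
      (fun η hη => mapsTo_sepDeriv_weakSzlenkDeriv T hε.le
        ((isClosedDerivation_weakSzlenkDeriv ε).isClosed_derivIter hcl η) hη) _ hy
    simp [h ε hε] at this
  · have := derivIter_weakSzlenkDeriv_subset_image T (ε := ε / 2)
      (isCompact_weakUnitBall (𝕜 := 𝕜) (Y := Y)) (ω ^ ξ)
    rw [h _ (half_pos hε), mul_div_cancel₀ ε two_ne_zero, Set.image_empty] at this
    exact Set.subset_empty_iff.1 this

/-! ### Ideal, linear and closure properties -/

theorem adjointDist_comp_le (T : X →L[𝕜] Y) (S : Y →L[𝕜] Z) (y z : WeakDual 𝕜 Z) :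
    adjointDist (S.comp T) y z ≤ adjointDist S y z * ‖T‖ := by
  rw [adjointDist_eq, adjointDist_eq, ← ContinuousLinearMap.comp_assoc]
  exact ContinuousLinearMap.opNorm_comp_le _ _

theorem adjointDist_add_le (S T : X →L[𝕜] Y) (y z : WeakDual 𝕜 Y) :
    adjointDist (S + T) y z ≤ adjointDist S y z + adjointDist T y z := by
  rw [adjointDist_eq, adjointDist_eq, adjointDist_eq, ContinuousLinearMap.comp_add]
  exact norm_add_le _ _

theorem comp_mem_SZ_right {ξ : Ordinal.{0}} (hξ : ξ < ω₁) {S : Y →L[𝕜] Z}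
    (hS : S ∈ SZ 𝕜 ξ Y Z) (T : X →L[𝕜] Y) : S.comp T ∈ SZ 𝕜 ξ X Z := by
  rw [mem_SZ_iff hξ] at hS ⊢
  intro ε hε
  have hc : 0 < ‖T‖ + 1 := by positivity
  refine derivIter_sepDeriv_eq_empty continuous_id isClosed_weakUnitBall (fun y _ z _ hyz => ?_)
    (Set.mapsTo_id _)
    (hS (ε / (‖T‖ + 1)) (by positivity))
  have h0 : 0 ≤ adjointDist S y z := dist_nonneg
  rw [div_lt_iff₀ hc]
  simp only [id]
  nlinarith [adjointDist_comp_le T S y z]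

theorem comp_mem_SZ_left {ξ : Ordinal.{0}} (hξ : ξ < ω₁) {S : X →L[𝕜] Y}
    (hS : S ∈ SZ 𝕜 ξ X Y) (R : Y →L[𝕜] Z) : R.comp S ∈ SZ 𝕜 ξ X Z := by
  rw [mem_SZ_iff hξ] at hS ⊢
  intro ε hε
  -- The adjoint of `c⁻¹ • R` maps the dual ball of `Z` into that of `Y`; the `+ 1` covers `R = 0`.
  set c : ℝ := ‖R‖ + 1
  have hc : 0 < c := by positivity
  have hc' : ‖((c⁻¹ : ℝ) : 𝕜)‖ = c⁻¹ := by
    rw [RCLike.norm_ofReal, abs_of_pos (inv_pos.2 hc)]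
  refine derivIter_sepDeriv_eq_empty (continuous_weakAdjoint (((c⁻¹ : ℝ) : 𝕜) • R))
    isClosed_weakUnitBall (fun y _ z _ hyz => ?_) (fun y hy => ?_) (hS (ε / c) (by positivity))
  · have : adjointDist S (weakAdjoint (((c⁻¹ : ℝ) : 𝕜) • R) y)
        (weakAdjoint (((c⁻¹ : ℝ) : 𝕜) • R) z) = c⁻¹ * adjointDist (R.comp S) y z := by
      rw [adjointDist_eq, adjointDist_eq, ← hc', ← norm_smul]
      congr 1
      ext x
      simp [weakAdjoint, mul_sub, abs_of_pos hc]
    rw [this, div_eq_inv_mul]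
    gcongr
  · have hy' : ‖WeakDual.toStrongDual y‖ ≤ 1 := mem_closedBall_zero_iff.1 hy
    refine mem_closedBall_zero_iff.2 ?_
    calc ‖(WeakDual.toStrongDual y).comp (((c⁻¹ : ℝ) : 𝕜) • R)‖
        ≤ ‖WeakDual.toStrongDual y‖ * ‖((c⁻¹ : ℝ) : 𝕜) • R‖ :=
          ContinuousLinearMap.opNorm_comp_le _ _
      _ ≤ 1 * (c⁻¹ * ‖R‖) := by
          rw [norm_smul, hc']
          gcongr
      _ ≤ 1 := by
          rw [one_mul, inv_mul_le_one₀ hc]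
          exact (lt_add_one _).le

theorem add_mem_SZ {ξ : Ordinal.{0}} (hξ : ξ < ω₁) {S T : X →L[𝕜] Y}
    (hS : S ∈ SZ 𝕜 ξ X Y) (hT : T ∈ SZ 𝕜 ξ X Y) : S + T ∈ SZ 𝕜 ξ X Y := by
  rw [mem_SZ_iff hξ] at hS hT ⊢
  intro ε hε
  rw [← mul_div_cancel₀ ε (two_ne_zero (α := ℝ))]
  exact derivIter_eq_empty_of_subset_union isClosed_weakUnitBall
    (isClosedDerivation_sepDeriv _ _) (isClosedDerivation_sepDeriv _ _)
    (sepDeriv_mono _ _) (sepDeriv_mono _ _) (sepDeriv_mono _ _)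
    (isClosedDerivation_sepDeriv _ _) (sepDeriv_add_subset (adjointDist_add_le S T) _)
    (sepDeriv_biUnion_subset _ _) (hS _ (half_pos hε)) (hT _ (half_pos hε))

theorem zero_mem_SZ {ξ : Ordinal.{0}} (hξ : ξ < ω₁) : (0 : X →L[𝕜] Y) ∈ SZ 𝕜 ξ X Y := by
  rw [mem_SZ_iff hξ]
  intro ε hε
  have hD := isClosedDerivation_sepDeriv (adjointDist (0 : X →L[𝕜] Y)) ε
  have h1 : (1 : Ordinal.{0}) ≤ ω ^ ξ :=
    Order.one_le_iff_pos.2 (Ordinal.opow_pos ξ Ordinal.omega0_pos)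
  refine Set.subset_eq_empty (hD.derivIter_antitone isClosed_weakUnitBall h1) ?_
  rw [← zero_add (1 : Ordinal.{0}), derivIter_add_one]
  simp [sepDeriv, adjointDist_eq, hε.not_gt]

theorem isClosed_SZ {ξ : Ordinal.{0}} (hξ : ξ < ω₁) : IsClosed (SZ 𝕜 ξ X Y) := by
  refine isClosed_of_closure_subset fun T hT => (mem_SZ_iff hξ).2 fun ε hε => ?_
  -- The dual ball has diameter at most 2, so replacing `T` by `S` costs less than `ε / 2`.
  obtain ⟨S, hS, hTS⟩ := Metric.mem_closure_iff.1 hT (ε / 4) (by positivity)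
  have hS' := (mem_SZ_iff hξ).1 hS (ε / 2) (half_pos hε)
  refine derivIter_sepDeriv_eq_empty continuous_id isClosed_weakUnitBall
    (fun y hy z hz hyz => ?_) (Set.mapsTo_id _) hS'
  have hadd := adjointDist_add_le S (T - S) y z
  have hsub : adjointDist (T - S) y z ≤ 2 * ‖T - S‖ := by
    rw [adjointDist_eq]
    refine (ContinuousLinearMap.opNorm_comp_le _ _).trans ?_
    gcongr
    have hy' : ‖WeakDual.toStrongDual y‖ ≤ 1 := mem_closedBall_zero_iff.1 hy
    have hz' : ‖WeakDual.toStrongDual z‖ ≤ 1 := mem_closedBall_zero_iff.1 hz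
    linarith [norm_sub_le (WeakDual.toStrongDual y) (WeakDual.toStrongDual z)]
  rw [add_sub_cancel] at hadd
  rw [dist_eq_norm] at hTS
  simp only [id]
  linarith

end Szlenk

theorem theorem5p7 {𝕜 : Type*} [RCLike 𝕜] {W X Y Z : Type*}
    [NormedAddCommGroup W] [NormedSpace 𝕜 W] [CompleteSpace W]
    [TopologicalSpace.SeparableSpace W]
    [NormedAddCommGroup X] [NormedSpace 𝕜 X] [CompleteSpace X]
    [TopologicalSpace.SeparableSpace X]
    [NormedAddCommGroup Y] [NormedSpace 𝕜 Y] [CompleteSpace Y]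
    [TopologicalSpace.SeparableSpace Y]
    [NormedAddCommGroup Z] [NormedSpace 𝕜 Z] [CompleteSpace Z]
    [TopologicalSpace.SeparableSpace Z]
    (ξ : Ordinal.{0}) (hξ : ξ < ω₁) :
    (∀ S ∈ SZ 𝕜 ξ X Y, ∀ (T : W →L[𝕜] X) (R : Y →L[𝕜] Z),
      R.comp (S.comp T) ∈ SZ 𝕜 ξ W Z) ∧
    (∃ M : Submodule 𝕜 (X →L[𝕜] Y), (M : Set (X →L[𝕜] Y)) = SZ 𝕜 ξ X Y) ∧
    IsClosed (SZ 𝕜 ξ X Y) := by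
  refine ⟨fun S hS T R => comp_mem_SZ_left hξ (comp_mem_SZ_right hξ hS T) R,
    ⟨{ carrier := SZ 𝕜 ξ X Y
       add_mem' := add_mem_SZ hξ
       zero_mem' := zero_mem_SZ hξ
       smul_mem' := fun c T hT => ?_ }, rfl⟩, isClosed_SZ hξ⟩
  -- Scaling is left composition with a multiple of the identity.
  simpa using comp_mem_SZ_left hξ hT (c • ContinuousLinearMap.id 𝕜 Y)
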